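/- **Theorem (local Gale duality for one solution).** Let $n,m\ge 0$ be integers and let $a_0,\dots,a_{n+m}\in\mathbb{Z}^n$ be $n+m+1$ distinct exponent vectors such that the matrix $A\in\mathbb{Z}^{(n+1)\times(n+m+1)}$ with columns $(1,a_j)^t$ has rank $n+1$. Let $C=(c_{ij})\in\mathbb{C}^{n\times(n+m+1)}$ have rank $n$ and consider the system of Laurent polynomials $$C\cdot x^A=0:\qquad f_i(x)=\sum_{j=0}^{n+m}c_{ij}\,x^{a_j}=0,\quad i=1,\dots,n,\qquad x\in(\mathbb{C}^*)^n .$$ A *Gale dual* of $A$ is an integer matrix $B=(b_{ik})\in\mathbb{Z}^{(n+m+1)\times m}$ (rows indexed by $0,\dots,n+m$) of rank $m$ with $AB=0$ (its columns need not generate the integer kernel of $A$). A *reduced Gale dual* of $C$ is a matrix $D=(d_{ij})\in\mathbb{C}^{(n+m+1)\times(m+1)}$ (rows indexed by $0,\dots,n+m$, columns by $0,\dots,m$) whose columns form a basis of the right kernel of $C$, with $d_{i0}=1$ for all $i$ and $d_{0j}=0$ for $j=1,\dots,m$. Given such $B$ and $D$, put $p_i(y)=1+\sum_{j=1}^m d_{ij}y_j$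 and let the *Gale system* be $$g_k(y)=\prod_{b_{ik}>0}p_i(y)^{b_{ik}}-\prod_{b_{ik}<0}p_i(y)^{-b_{ik}}=0,\quad k=1,\dots,m,\qquad y\in\mathbb{C}^m .$$ A solution is *isolated* if it is the only solution in some neighbourhood of it. The multiplicity of a system at an isolated solution $q$ is the dimension over $\mathbb{C}$ of the localization at $q$ of the quotient of the ring (of Laurent polynomials in $x$, respectively of polynomials in $y$) by the ideal generated by the equations of the system. Then: 1. For every Gale dual $B$ of $A$, every reduced Gale dual $D$ of $C$ and every natural number $\mu$, the point $\mathbf 1=(1,\dots,1)\in(\mathbb{C}^*)^n$ is an isolated solution of multiplicity $\mu$ of $C\cdot x^A=0$ if and only if $\mathbf 0\in\mathbb{C}^m$ is an isolated solution of multiplicity $\mu$ of $g_1=\cdots=g_m=0$. 2. Consequently, the multiplicity at the origin of the Gale system depends neither on the choice of $B$ nor on that of $D$: if $B,B'$ are Gale duals of $A$ and $D,D'$ are reduced Gale duals of $C$, then for every natural number $\mu$, the origin is an isolated solution of multiplicity $\mu$ of the Gale system of $(B,D)$ if and only if it is one of the Gale system of $(B',D')$. -/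

import Mathlib

open Topology

noncomputable section

namespace LocalGale

/-- `p` is an isolated point of the solution set `Z`: it is a solution, and the only one in some
neighbourhood of `p`. -/
def IsIsolatedIn {X : Type*} [TopologicalSpace X] (Z : Set X) (p : X) : Prop :=
  p ∈ Z ∧ ∀ᶠ x in 𝓝 p, x ∈ Z → x = p

instance ker_isPrime {R : Type} [CommRing R] [Algebra ℂ R] (q : R →ₐ[ℂ] ℂ) :
    (RingHom.ker q).IsPrime :=
  RingHom.ker_isPrime q

/-- The local multiplicity of the system `f = 0` at a `ℂ`-point `q` of `Spec R`, given by its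
evaluation homomorphism: the dimension over `ℂ` of the localization at `q` of `R / ⟨f⟩`, i.e. of
`R_𝔪 / ⟨f⟩ R_𝔪` with `𝔪 = ker q`. -/
def localMultiplicity {R ι : Type} [CommRing R] [Algebra ℂ R] (f : ι → R) (q : R →ₐ[ℂ] ℂ) :
    Cardinal :=
  Module.rank ℂ (Localization.AtPrime (RingHom.ker q) ⧸
    (Ideal.span (Set.range f)).map (algebraMap R (Localization.AtPrime (RingHom.ker q))))

/-! ### Laurent polynomials -/

/-- Laurent polynomials in `n` variables over `ℂ`: the group algebra of `ℤⁿ`. -/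
abbrev Laurent (n : ℕ) : Type := AddMonoidAlgebra ℂ (Fin n → ℤ)

/-- The character `a ↦ x ^ a = ∏ x_l ^ a_l` of `ℤⁿ` attached to a point `x` of the torus. -/
def torusChar {n : ℕ} (x : Fin n → ℂˣ) : Multiplicative (Fin n → ℤ) →* ℂ where
  toFun a := ((∏ l, x l ^ (a.toAdd l) : ℂˣ) : ℂ)
  map_one' := by simp
  map_mul' a b := by simp [zpow_add, Finset.prod_mul_distrib]

/-- Evaluation of Laurent polynomials at a point of the torus `(ℂ*)ⁿ`. -/
def laurentEval {n : ℕ} (x : Fin n → ℂˣ) : Laurent n →ₐ[ℂ] ℂ :=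
  AddMonoidAlgebra.lift ℂ ℂ (Fin n → ℤ) (torusChar x)

/-- The Laurent polynomials `f_i = ∑ j, c_{ij} x ^ {a_j}` of the system `C · x ^ A = 0`. -/
def sparseSystem {n N : ℕ} (C : Matrix (Fin n) (Fin N) ℂ) (a : Fin N → Fin n → ℤ) :
    Fin n → Laurent n :=
  fun i => ∑ j, AddMonoidAlgebra.single (a j) (C i j)

/-- `x` is an isolated solution in the torus, of multiplicity `μ`, of the Laurent polynomial
system `f = 0`. -/
def IsIsolatedTorusRoot {n : ℕ} {ι : Type} (f : ι → Laurent n) (x : Fin n → ℂˣ) (μ : ℕ) : Prop :=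
  IsIsolatedIn {z : Fin n → ℂˣ | ∀ i, laurentEval z (f i) = 0} x ∧
    localMultiplicity f (laurentEval x) = μ

/-- `y` is an isolated solution in `ℂᵐ`, of multiplicity `μ`, of the polynomial system `g = 0`. -/
def IsIsolatedAffineRoot {m : ℕ} {ι : Type} (g : ι → MvPolynomial (Fin m) ℂ) (y : Fin m → ℂ)
    (μ : ℕ) : Prop :=
  IsIsolatedIn {z : Fin m → ℂ | ∀ k, MvPolynomial.aeval z (g k) = 0} y ∧
    localMultiplicity g (MvPolynomial.aeval y) = μ

/-! ### Gale duality -/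

/-- The matrix with columns `(1, a_j)`. -/
def exponentMatrix {n N : ℕ} (a : Fin N → Fin n → ℤ) : Matrix (Fin (n + 1)) (Fin N) ℤ :=
  Matrix.of (Fin.cons (fun _ => 1) (fun l j => a j l))

/-- `B` is a Gale dual matrix of (the exponent matrix of) `a`: an integer matrix of full rank `m`
whose columns lie in the kernel. The columns need not form a `ℤ`-basis of the integer kernel. -/
structure IsGaleDualExponents {n m : ℕ} (a : Fin (n + m + 1) → Fin n → ℤ)
    (B : Matrix (Fin (n + m + 1)) (Fin m) ℤ) : Prop where
  mul_eq_zero : exponentMatrix a * B = 0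
  rank_eq : (B.map (Int.cast : ℤ → ℚ)).rank = m

/-- `D` is a reduced Gale dual matrix of `C`: its columns form a basis of the right kernel of `C`,
its first column is `(1, …, 1)`, and its first row is `(1, 0, …, 0)`. -/
structure IsReducedGaleDual {n m : ℕ} (C : Matrix (Fin n) (Fin (n + m + 1)) ℂ)
    (D : Matrix (Fin (n + m + 1)) (Fin (m + 1)) ℂ) : Prop where
  linearIndependent : LinearIndependent ℂ D.col
  span_eq : Submodule.span ℂ (Set.range D.col) = LinearMap.ker C.mulVecLin
  col_zero : ∀ i, D i 0 = 1
  row_zero : ∀ j : Fin m, D 0 j.succ = 0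

/-- The degree-one polynomial `p_i = d_{i0} + ∑ j, d_{ij} y_j` of the `i`-th row of `D`. -/
def rowPolynomial {m N : ℕ} (D : Matrix (Fin N) (Fin (m + 1)) ℂ) (i : Fin N) :
    MvPolynomial (Fin m) ℂ :=
  MvPolynomial.C (D i 0) + ∑ j : Fin m, MvPolynomial.C (D i j.succ) * MvPolynomial.X j

/-- The Gale system
`g_k = ∏_{b_{ik} > 0} p_i ^ b_{ik} - ∏_{b_{ik} < 0} p_i ^ (-b_{ik})`. -/
def galeSystem {m N : ℕ} (B : Matrix (Fin N) (Fin m) ℤ) (D : Matrix (Fin N) (Fin (m + 1)) ℂ) :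
    Fin m → MvPolynomial (Fin m) ℂ :=
  fun k => ∏ i with 0 < B i k, rowPolynomial D i ^ (B i k).toNat -
    ∏ i with B i k < 0, rowPolynomial D i ^ (-B i k).toNat

end LocalGale

end

open Topology

noncomputable section

namespace LocalGale

/-! ### Multiplicity at a point, read off from jets -/

section LocalRing

/-! The Gale correspondence pairs `x` with `y` when `p_i(y) = x ^ (a_i - a_0)` for all `i`
(`IsDualPair`). It pairs `1` with `0`, and it makes sense over any `ℂ`-algebra `S`. From a solution
`x` of the sparse system, exactness of `D` followed by `C` produces a unique `y`. Conversely, a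
solution `y` of the Gale system with units `p_i(y)` satisfies `p ^ B = 1`, and `x` must be recovered
from `p`. The integer matrices split only up to a nonzero integer `d` (`exists_int_splitting`), so
this requires `d`-th roots. When `y` is nilpotent each `p_i(y)` is a unipotent unit, and among these
`d`-th roots exist and are unique (`existsUnique_pow_eq_of_isNilpotent_sub_one`). Hence lattice
indices have no influence near `1` and `0`.

Applied to the universal points of the algebras of `k`-jets, this yields mutually inverse
homomorphisms, so these algebras are isomorphic for every `k ≥ 1` (`rank_jets_eq`). A finite
multiplicity is the eventual dimension of the jets (`localMultiplicity_eq_iff`), and it forces the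
solution to be isolated (`isIsolatedIn_of_localMultiplicity_eq`). Independence of `B` and `D`
follows because the sparse system involves neither. -/

theorem finite_of_rank_eq_natCast {V : Type} [AddCommGroup V] [Module ℂ V] {μ : ℕ}
    (h : Module.rank ℂ V = μ) : Module.Finite ℂ V := by
  rw [← Module.rank_lt_aleph0_iff, h]
  exact Cardinal.natCast_lt_aleph0

variable {R : Type} [CommRing R] [Algebra ℂ R]

/-- Up to the constant `q s`, the element `s` is `1 - u` with `u` in the kernel; a finite geometric
series inverts `1 - u` modulo `u ^ k`. -/
theorem exists_mul_sub_one_mem_ker_pow (q : R →ₐ[ℂ] ℂ) (k : ℕ) {s : R}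
    (hs : s ∉ RingHom.ker q) : ∃ t, s * t - 1 ∈ RingHom.ker q ^ k := by
  rw [RingHom.mem_ker] at hs
  set u : R := 1 - s * algebraMap ℂ R (q s)⁻¹ with hu
  have hum : u ∈ RingHom.ker q := by
    simp [hu, RingHom.mem_ker, hs]
  obtain ⟨w, hw⟩ := sub_dvd_pow_sub_pow 1 u k
  refine ⟨algebraMap ℂ R (q s)⁻¹ * w, ?_⟩
  have : s * (algebraMap ℂ R (q s)⁻¹ * w) - 1 = -u ^ k := by
    have h1 : (1 : R) - u = s * algebraMap ℂ R (q s)⁻¹ := by rw [hu]; ring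
    rw [h1, one_pow] at hw
    rw [← mul_assoc, ← hw]; ring
  rw [this]
  exact neg_mem (Ideal.pow_mem_pow hum k)

/-- An ideal containing a power of the maximal ideal at a point has the same quotient before and
after localization. -/
theorem rank_quotient_eq_rank_localization (q : R →ₐ[ℂ] ℂ) {J : Ideal R} {k : ℕ}
    (hJ : RingHom.ker q ^ k ≤ J) :
    Module.rank ℂ (R ⧸ J) = Module.rank ℂ (Localization.AtPrime (RingHom.ker q) ⧸
      J.map (algebraMap R (Localization.AtPrime (RingHom.ker q)))) := by
  let M := Localization.AtPrime (RingHom.ker q)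
  let φ : (R ⧸ J) →ₐ[ℂ] (M ⧸ J.map (algebraMap R M)) :=
    Ideal.quotientMapₐ (J.map (algebraMap R M)) (Algebra.algHom ℂ R M) Ideal.le_comap_map
  refine (LinearEquiv.ofBijective φ.toLinearMap ⟨?_, ?_⟩).rank_eq
  · rw [injective_iff_map_eq_zero]
    intro x hx
    obtain ⟨r, rfl⟩ := Ideal.Quotient.mk_surjective x
    have hr : algebraMap R M r ∈ J.map (algebraMap R M) := Ideal.Quotient.eq_zero_iff_mem.1 hx
    rw [IsLocalization.algebraMap_mem_map_algebraMap_iff (RingHom.ker q).primeCompl] at hr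
    obtain ⟨s, hs, hsr⟩ := hr
    obtain ⟨t, ht⟩ := exists_mul_sub_one_mem_ker_pow q k hs
    rw [Ideal.Quotient.eq_zero_iff_mem]
    have : r = t * (s * r) - r * (s * t - 1) := by ring
    rw [this]
    exact sub_mem (J.mul_mem_left _ hsr) (J.mul_mem_left _ (hJ ht))
  · intro x
    obtain ⟨z, rfl⟩ := Ideal.Quotient.mk_surjective x
    obtain ⟨r, s, rfl⟩ := IsLocalization.exists_mk'_eq (RingHom.ker q).primeCompl z
    obtain ⟨t, ht⟩ := exists_mul_sub_one_mem_ker_pow q k s.2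
    refine ⟨Ideal.Quotient.mk _ (r * t), ?_⟩
    refine (Ideal.Quotient.eq (I := J.map (algebraMap R M))
      (x := algebraMap R M (r * t)) (y := IsLocalization.mk' M r s)).2 ?_
    have : algebraMap R M (r * t) - IsLocalization.mk' M r s =
        IsLocalization.mk' M r s * algebraMap R M (s * t - 1) := by
      rw [map_sub, mul_sub, map_one, mul_one, map_mul, map_mul, ← mul_assoc,
        IsLocalization.mk'_spec]
    rw [this]
    exact Ideal.mul_mem_left _ _ (Ideal.mem_map_of_mem _ (hJ ht))

/-- A finite-dimensional local algebra is Artinian, so its maximal ideal is nilpotent. -/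
theorem exists_map_ker_pow_le_of_localMultiplicity_eq {ι : Type} {f : ι → R} {q : R →ₐ[ℂ] ℂ} {μ : ℕ}
    (h : localMultiplicity f q = μ) (hf : ∀ i, q (f i) = 0) :
    ∃ K, (RingHom.ker q ^ K).map (algebraMap R (Localization.AtPrime (RingHom.ker q))) ≤
      (Ideal.span (Set.range f)).map (algebraMap R (Localization.AtPrime (RingHom.ker q))) := by
  let M := Localization.AtPrime (RingHom.ker q)
  set I := (Ideal.span (Set.range f)).map (algebraMap R M) with hI
  have hfin : Module.Finite ℂ (M ⧸ I) :=
    finite_of_rank_eq_natCast h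
  have hart : IsArtinianRing (M ⧸ I) := IsArtinianRing.of_finite ℂ _
  have hle : I ≤ IsLocalRing.maximalIdeal M := by
    rw [hI, ← Localization.AtPrime.map_eq_maximalIdeal]
    refine Ideal.map_mono (Ideal.span_le.2 ?_)
    rintro _ ⟨i, rfl⟩
    exact hf i
  obtain ⟨K, hK⟩ := IsArtinianRing.isNilpotent_jacobson_bot (R := M ⧸ I)
  have : Nontrivial (M ⧸ I) := Ideal.Quotient.nontrivial_iff.2
    (fun e => (IsLocalRing.maximalIdeal.isMaximal M).ne_top (top_le_iff.1 (e ▸ hle)))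
  have : IsLocalRing (M ⧸ I) := .of_surjective' (Ideal.Quotient.mk I) Ideal.Quotient.mk_surjective
  refine ⟨K, ?_⟩
  rw [Ideal.map_pow, Localization.AtPrime.map_eq_maximalIdeal]
  have h2 : ((IsLocalRing.maximalIdeal M) ^ K).map (Ideal.Quotient.mk I) = ⊥ := by
    rw [Ideal.map_pow, eq_bot_iff]
    rw [IsLocalRing.jacobson_eq_maximalIdeal _ bot_ne_top] at hK
    refine le_trans (Ideal.pow_right_mono ?_ K) hK.le
    have := Ideal.comap_isMaximal_of_surjective (Ideal.Quotient.mk I) Ideal.Quotient.mk_surjective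
      (K := IsLocalRing.maximalIdeal (M ⧸ I))
    rw [Ideal.map_le_iff_le_comap, IsLocalRing.eq_maximalIdeal this]
  rwa [Ideal.map_eq_bot_iff_le_ker, Ideal.mk_ker] at h2

/-- The multiplicity at a solution is `μ` if and only if the jets of high order at that point form
a space of dimension `μ`. -/
theorem localMultiplicity_eq_iff [IsNoetherianRing R] {ι : Type} {f : ι → R} {q : R →ₐ[ℂ] ℂ}
    {μ : ℕ} (hf : ∀ i, q (f i) = 0) :
    localMultiplicity f q = μ ↔ ∃ K, ∀ k ≥ K,
      Module.rank ℂ (R ⧸ (Ideal.span (Set.range f) ⊔ RingHom.ker q ^ k)) = μ := by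
  let M := Localization.AtPrime (RingHom.ker q)
  let I := Ideal.span (Set.range f)
  have key (k : ℕ) : Module.rank ℂ (R ⧸ (I ⊔ RingHom.ker q ^ k)) =
      Module.rank ℂ (M ⧸ (I ⊔ RingHom.ker q ^ k).map (algebraMap R M)) :=
    rank_quotient_eq_rank_localization q le_sup_right
  constructor
  · intro h
    obtain ⟨K, hK⟩ := exists_map_ker_pow_le_of_localMultiplicity_eq h hf
    refine ⟨K, fun k hk => ?_⟩
    have e : (I ⊔ RingHom.ker q ^ k).map (algebraMap R M) = I.map (algebraMap R M) := by
      rw [Ideal.map_sup, sup_eq_left]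
      exact (Ideal.map_mono (Ideal.pow_le_pow_right hk)).trans hK
    rw [key, e]
    exact h
  · rintro ⟨K, hK⟩
    -- Equal dimensions at `K` and `K + 1` make the surjection between the quotients injective, so
    -- `𝔪 ^ K ≤ I + 𝔪 ^ (K + 1)` in the localization; Nakayama then gives `𝔪 ^ K ≤ I`.
    have hle : (I ⊔ RingHom.ker q ^ (K + 1)).map (algebraMap R M) ≤
        (I ⊔ RingHom.ker q ^ K).map (algebraMap R M) :=
      Ideal.map_mono (sup_le_sup_left (Ideal.pow_le_pow_right K.le_succ) _)
    have h1 := (key K).symm.trans (hK K le_rfl)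
    have h2 := (key (K + 1)).symm.trans (hK (K + 1) K.le_succ)
    have fin2 : Module.Finite ℂ (M ⧸ (I ⊔ RingHom.ker q ^ (K + 1)).map (algebraMap R M)) :=
      finite_of_rank_eq_natCast h2
    have fin1 : Module.Finite ℂ (M ⧸ (I ⊔ RingHom.ker q ^ K).map (algebraMap R M)) :=
      finite_of_rank_eq_natCast h1
    have hinj : Function.Injective (Ideal.Quotient.factorₐ ℂ hle).toLinearMap := by
      rw [LinearMap.injective_iff_surjective_of_finrank_eq_finrank]
      · exact Ideal.Quotient.factor_surjective hle
      · rw [Module.finrank, Module.finrank, h1, h2]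
    have hge : (I ⊔ RingHom.ker q ^ K).map (algebraMap R M) ≤
        (I ⊔ RingHom.ker q ^ (K + 1)).map (algebraMap R M) := by
      intro x hx
      rw [← Ideal.Quotient.eq_zero_iff_mem]
      apply hinj
      rw [map_zero]
      exact Ideal.Quotient.eq_zero_iff_mem.2 hx
    have hN : (RingHom.ker q ^ K).map (algebraMap R M) ≤ I.map (algebraMap R M) := by
      refine Submodule.le_of_le_smul_of_le_jacobson_bot (I := IsLocalRing.maximalIdeal M)
        ((isNoetherianRing_iff_ideal_fg M).1 (IsLocalization.isNoetherianRing
          (RingHom.ker q).primeCompl M inferInstance) _)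
        (IsLocalRing.maximalIdeal_le_jacobson _) ?_
      rw [← Localization.AtPrime.map_eq_maximalIdeal, smul_eq_mul, ← Ideal.map_mul, ← pow_succ',
        ← Ideal.map_sup]
      exact (Ideal.map_mono le_sup_right).trans hge
    have e : (I ⊔ RingHom.ker q ^ K).map (algebraMap R M) = I.map (algebraMap R M) := by
      rw [Ideal.map_sup, sup_eq_left]
      exact hN
    rw [e] at h1
    exact h1

/-- At a solution of finite multiplicity, some power of each function vanishing there lies in the
ideal of the system, up to a factor that does not vanish there. -/
theorem exists_mul_pow_mem_of_localMultiplicity_eq {ι : Type} {f : ι → R} {q : R →ₐ[ℂ] ℂ} {μ : ℕ}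
    (h : localMultiplicity f q = μ) (hf : ∀ i, q (f i) = 0) {r : R} (hr : q r = 0) :
    ∃ s k, q s ≠ 0 ∧ s * r ^ k ∈ Ideal.span (Set.range f) := by
  obtain ⟨K, hK⟩ := exists_map_ker_pow_le_of_localMultiplicity_eq h hf
  have := hK (Ideal.mem_map_of_mem _ (Ideal.pow_mem_pow (I := RingHom.ker q) hr K))
  rw [IsLocalization.algebraMap_mem_map_algebraMap_iff (RingHom.ker q).primeCompl] at this
  obtain ⟨s, hs, h⟩ := this
  exact ⟨s, K, hs, h⟩

theorem eq_zero_of_mem_span_range {ι : Type} {f : ι → R} {z : R →ₐ[ℂ] ℂ} (hz : ∀ i, z (f i) = 0)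
    {r : R} (hr : r ∈ Ideal.span (Set.range f)) : z r = 0 := by
  have : Ideal.span (Set.range f) ≤ RingHom.ker z := by
    rw [Ideal.span_le]
    rintro _ ⟨i, rfl⟩
    exact hz i
  exact this hr

/-- A solution of finite multiplicity is isolated, for a family of points `z` of `Spec R`
parametrized continuously by `X` and separated by finitely many functions. -/
theorem isIsolatedIn_of_localMultiplicity_eq {X ι κ : Type} [TopologicalSpace X] [Finite κ]
    {f : ι → R} {z : X → R →ₐ[ℂ] ℂ} (hz : ∀ r, Continuous fun x => z x r) {p : X} {μ : ℕ}
    (r : κ → R) (hr : ∀ j, z p (r j) = 0) (hsep : ∀ x, (∀ j, z x (r j) = 0) → x = p)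
    (hf : ∀ i, z p (f i) = 0) (h : localMultiplicity f (z p) = μ) :
    IsIsolatedIn {x | ∀ i, z x (f i) = 0} p := by
  refine ⟨hf, ?_⟩
  choose s k hs hmem using fun j => exists_mul_pow_mem_of_localMultiplicity_eq h hf (hr j)
  have hev : ∀ᶠ x in 𝓝 p, ∀ j, z x (s j) ≠ 0 :=
    Filter.eventually_all.2 fun j => (hz (s j)).continuousAt.eventually_ne (hs j)
  filter_upwards [hev] with x hx hxf
  refine hsep x fun j => ?_
  have h0 := eq_zero_of_mem_span_range hxf (hmem j)
  rw [map_mul, map_pow] at h0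
  exact eq_zero_of_pow_eq_zero ((mul_eq_zero.1 h0).resolve_left (hx j))

end LocalRing


/-! ### Unipotent units and their unique divisibility -/

section UnipotentUnits

variable {S : Type} [CommRing S]

/-- The units that differ from `1` by a nilpotent element. -/
def unipotentUnits (S : Type) [CommRing S] : Subgroup Sˣ where
  carrier := {u | IsNilpotent ((u : S) - 1)}
  one_mem' := by simp
  mul_mem' {u v} hu hv := by
    have : ((u * v : Sˣ) : S) - 1 = (u : S) * (v - 1) + (u - 1) := by push_cast; ring
    rw [Set.mem_ofPred_eq, this]
    exact (Commute.all _ _).isNilpotent_add ((Commute.all _ _).isNilpotent_mul_left hv) hu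
  inv_mem' {u} hu := by
    have : ((u⁻¹ : Sˣ) : S) - 1 = -((u⁻¹ : Sˣ) : S) * (u - 1) := by
      rw [mul_sub, neg_mul, Units.inv_mul]; ring
    rw [Set.mem_ofPred_eq, this]
    exact (Commute.all _ _).isNilpotent_mul_left hu

theorem mem_unipotentUnits {u : Sˣ} : u ∈ unipotentUnits S ↔ IsNilpotent ((u : S) - 1) :=
  Iff.rfl

theorem map_mem_unipotentUnits {T : Type} [CommRing T] (φ : S →+* T) {u : Sˣ}
    (hu : u ∈ unipotentUnits S) : Units.map (φ : S →* T) u ∈ unipotentUnits T := by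
  have := (mem_unipotentUnits.1 hu).map φ
  simpa [mem_unipotentUnits] using this

/-- Newton's method for `X ^ d - t` starting at `1`: the value there is nilpotent and the derivative
`d` is invertible in a `ℂ`-algebra. -/
theorem existsUnique_pow_eq_of_isNilpotent_sub_one [Algebra ℂ S] {d : ℕ} (hd : d ≠ 0) {t : S}
    (ht : IsNilpotent (t - 1)) : ∃! r : S, IsNilpotent (1 - r) ∧ r ^ d = t := by
  have h1 : IsNilpotent (Polynomial.aeval (1 : S) (Polynomial.X ^ d - Polynomial.C t)) := by
    rw [← isNilpotent_neg_iff]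
    simpa using ht
  have h2 : IsUnit (Polynomial.aeval (1 : S)
      (Polynomial.derivative (Polynomial.X ^ d - Polynomial.C t))) := by
    have : IsUnit (algebraMap ℂ S d) := (IsUnit.mk0 (d : ℂ) (by exact_mod_cast hd)).map _
    simpa [Polynomial.derivative_X_pow] using this
  obtain ⟨r, hr, hu⟩ := Polynomial.existsUnique_nilpotent_sub_and_aeval_eq_zero h1 h2
  refine ⟨r, ⟨hr.1, by simpa [sub_eq_zero] using hr.2⟩, fun s hs => hu s ⟨hs.1, ?_⟩⟩
  simp [hs.2]

/-- Extraction of roots is possible and unique among unipotent units. -/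
theorem exists_pow_eq_of_mem_unipotentUnits [Algebra ℂ S] {d : ℕ} (hd : d ≠ 0) {t : Sˣ}
    (ht : t ∈ unipotentUnits S) : ∃ u ∈ unipotentUnits S, u ^ d = t := by
  obtain ⟨r, ⟨hr, hrt⟩, -⟩ := existsUnique_pow_eq_of_isNilpotent_sub_one hd ht
  have hu : IsUnit r := (isUnit_pow_iff hd).1 (hrt ▸ t.isUnit)
  refine ⟨hu.unit, ?_, Units.ext (by simpa using hrt)⟩
  rw [mem_unipotentUnits, ← isNilpotent_neg_iff]
  simpa using hr

theorem eq_of_pow_eq_of_mem_unipotentUnits [Algebra ℂ S] {d : ℕ} (hd : d ≠ 0) {u v : Sˣ}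
    (hu : u ∈ unipotentUnits S) (hv : v ∈ unipotentUnits S) (h : u ^ d = v ^ d) : u = v := by
  have aux {w : Sˣ} (hw : w ∈ unipotentUnits S) : IsNilpotent (1 - (w : S)) := by
    rw [← isNilpotent_neg_iff, neg_sub]
    exact hw
  exact Units.ext ((existsUnique_pow_eq_of_isNilpotent_sub_one hd
    (t := ((v ^ d : Sˣ) : S)) (pow_mem hv d)).unique ⟨aux hu, by rw [← h]; simp⟩
    ⟨aux hv, by simp⟩)

end UnipotentUnits

/-! ### Monomial maps with integer exponent matrices -/

section MatrixPow

variable {ι κ τ : Type} [Fintype ι] [Fintype κ] {G H : Type} [CommGroup G] [CommGroup H]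

theorem zpow_sum (g : G) (f : ι → ℤ) : g ^ (∑ i, f i) = ∏ i, g ^ f i := by
  classical
  induction (Finset.univ : Finset ι) using Finset.induction_on with
  | empty => simp
  | insert i s hi ih => rw [Finset.sum_insert hi, Finset.prod_insert hi, zpow_add, ih]

/-- The monomials `∏ i, p i ^ E i l` in the entries of `p` with exponents the columns of `E`. -/
def matrixPow (p : ι → G) (E : Matrix ι τ ℤ) : τ → G :=
  fun l => ∏ i, p i ^ E i l

/-- Turns matrix identities among exponents into identities among monomials. -/
theorem matrixPow_mul (p : ι → G) (E : Matrix ι κ ℤ) (F : Matrix κ τ ℤ) :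
    matrixPow p (E * F) = matrixPow (matrixPow p E) F := by
  funext l
  simp only [matrixPow, Matrix.mul_apply, ← Finset.prod_zpow, ← zpow_mul, zpow_sum]
  exact Finset.prod_comm

theorem matrixPow_add (p : ι → G) (E F : Matrix ι τ ℤ) :
    matrixPow p (E + F) = matrixPow p E * matrixPow p F := by
  funext l
  simp [matrixPow, zpow_add, Finset.prod_mul_distrib]

theorem matrixPow_smul_one [DecidableEq ι] (p : ι → G) (d : ℕ) (i : ι) :
    matrixPow p (d • (1 : Matrix ι ι ℤ)) i = p i ^ d := by
  rw [matrixPow, Finset.prod_eq_single i] <;> simp +contextual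

theorem matrixPow_zero (p : ι → G) : matrixPow p (0 : Matrix ι τ ℤ) = 1 := by
  funext l
  simp [matrixPow]

theorem matrixPow_one (E : Matrix ι τ ℤ) : matrixPow (1 : ι → G) E = 1 := by
  funext l
  simp [matrixPow]

theorem map_matrixPow (φ : G →* H) (p : ι → G) (E : Matrix ι τ ℤ) (l : τ) :
    φ (matrixPow p E l) = matrixPow (fun i => φ (p i)) E l := by
  simp [matrixPow]

theorem matrixPow_mem (K : Subgroup G) {p : ι → G} (hp : ∀ i, p i ∈ K) (E : Matrix ι τ ℤ) (l : τ) :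
    matrixPow p E l ∈ K :=
  prod_mem fun i _ => zpow_mem (hp i) _

end MatrixPow

/-! ### Splittings over a field and over the integers -/

section LinearAlgebra

variable {ι κ τ : Type} [Fintype ι] [Fintype κ] [Fintype τ] [DecidableEq ι] [DecidableEq κ]

/-- Splitting of a short exact sequence given by two matrices of full rank. -/
theorem exists_splitting {K : Type} [Field K] [DecidableEq τ] {A : Matrix κ ι K} {B : Matrix ι τ K}
    (hAB : A * B = 0) (hA : A.rank = Fintype.card κ) (hB : B.rank = Fintype.card τ)
    (hcard : Fintype.card ι = Fintype.card κ + Fintype.card τ) :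
    ∃ (E : Matrix ι κ K) (W : Matrix τ ι K), A * E = 1 ∧ W * B = 1 ∧ E * A + B * W = 1 := by
  have hsurj : Function.Surjective A.mulVec := by
    have : LinearMap.range A.mulVecLin = ⊤ :=
      Submodule.eq_top_of_finrank_eq (by rw [← Matrix.rank, hA, Module.finrank_fintype_fun_eq_card])
    exact LinearMap.range_eq_top.1 this
  have hinj : Function.Injective B.mulVec := by
    have : LinearMap.ker B.mulVecLin = ⊥ := by
      have := B.mulVecLin.finrank_range_add_finrank_ker
      rw [← Matrix.rank, Module.finrank_fintype_fun_eq_card] at this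
      exact Submodule.finrank_eq_zero.1 (by omega)
    exact LinearMap.ker_eq_bot.1 this
  obtain ⟨E, hE⟩ := Matrix.mulVec_surjective_iff_exists_right_inverse.1 hsurj
  -- Exactness in the middle is a dimension count. The columns of `1 - E * A` lie in `ker A`, and
  -- their preimages under `B` form `W`.
  have hker : LinearMap.range B.mulVecLin = LinearMap.ker A.mulVecLin := by
    refine Submodule.eq_of_le_of_finrank_eq ?_ ?_
    · rw [LinearMap.range_le_ker_iff, ← Matrix.mulVecLin_mul, hAB, Matrix.mulVecLin_zero]
    · have := A.mulVecLin.finrank_range_add_finrank_ker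
      rw [← Matrix.rank, Module.finrank_fintype_fun_eq_card] at this
      rw [← Matrix.rank]
      omega
  have hW (i : ι) : ∃ w : τ → K, B.mulVec w = (1 - E * A).col i := by
    have : (1 - E * A).col i ∈ LinearMap.range B.mulVecLin := by
      rw [hker, LinearMap.mem_ker, Matrix.mulVecLin_apply, ← Matrix.mulVec_single_one,
        Matrix.mulVec_mulVec, Matrix.mul_sub, ← Matrix.mul_assoc, hE,
        Matrix.mul_one, Matrix.one_mul, sub_self, Matrix.zero_mulVec]
    exact this
  choose w hw using hW
  have hBW : B * (Matrix.of fun k i => w i k) = 1 - E * A := by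
    ext i j
    exact congrFun (hw j) i
  refine ⟨E, Matrix.of fun k i => w i k, hE, ?_, by rw [hBW]; abel⟩
  have h : B * ((Matrix.of fun k i => w i k) * B) = B * (1 : Matrix τ τ K) := by
    rw [← Matrix.mul_assoc, hBW, Matrix.sub_mul, Matrix.mul_assoc, hAB, Matrix.one_mul,
      Matrix.mul_zero, sub_zero, Matrix.mul_one]
  ext k j
  have := @hinj (((Matrix.of fun k i => w i k) * B).col j) ((1 : Matrix τ τ K).col j) (by
    ext i
    exact congrFun (congrFun h i) j)
  exact congrFun this k

/-- Clear denominators in a rational splitting. The factor `d` cannot be avoided: the columns of `A`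
may generate a proper sublattice, and those of `B` a proper subgroup of the kernel. -/
theorem exists_int_splitting [DecidableEq τ] {A : Matrix κ ι ℤ} {B : Matrix ι τ ℤ} (hAB : A * B = 0)
    (hA : (A.map (Int.cast : ℤ → ℚ)).rank = Fintype.card κ)
    (hB : (B.map (Int.cast : ℤ → ℚ)).rank = Fintype.card τ)
    (hcard : Fintype.card ι = Fintype.card κ + Fintype.card τ) :
    ∃ (d : ℕ) (E : Matrix ι κ ℤ) (W : Matrix τ ι ℤ), d ≠ 0 ∧ A * E = d • 1 ∧
      E * A + B * W = d • 1 := by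
  have map_mul' {α β γ : Type} [Fintype β] (X : Matrix α β ℤ) (Y : Matrix β γ ℤ) :
      (X * Y).map (Int.cast : ℤ → ℚ) =
        X.map (Int.cast : ℤ → ℚ) * Y.map (Int.cast : ℤ → ℚ) :=
    Matrix.map_mul (f := Int.castRingHom ℚ)
  have hAB' : A.map (Int.cast : ℤ → ℚ) * B.map (Int.cast : ℤ → ℚ) = 0 := by
    rw [← map_mul' A B, hAB]
    ext
    simp
  obtain ⟨E, W, hE, -, hW⟩ := exists_splitting hAB' hA hB hcard
  obtain ⟨b, hb⟩ := IsLocalization.exist_integer_multiples_of_finite (nonZeroDivisors ℤ)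
    (Sum.elim (fun x : ι × κ => E x.1 x.2) (fun x : τ × ι => W x.1 x.2))
  have hb0 : (b : ℤ) ≠ 0 := nonZeroDivisors.ne_zero b.2
  choose z hz using hb
  have hinj {α β : Type} : Function.Injective
      (fun X : Matrix α β ℤ => X.map (Int.cast : ℤ → ℚ)) :=
    Matrix.map_injective Int.cast_injective
  -- The common denominator `b` may be negative; its sign `s` corrects this.
  obtain ⟨d, s, hd0, hds⟩ : ∃ (d : ℕ) (s : ℤ), d ≠ 0 ∧ s * (b : ℤ) = d :=
    ⟨(b : ℤ).natAbs, (b : ℤ).sign, Int.natAbs_ne_zero.2 hb0, Int.sign_mul_self_eq_natAbs _⟩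
  have hdq : (s : ℚ) * ((b : ℤ) : ℚ) = d := by exact_mod_cast hds
  have hz' (x) : ((s * z x : ℤ) : ℚ) = d * Sum.elim (fun x : ι × κ => E x.1 x.2)
      (fun x : τ × ι => W x.1 x.2) x := by
    have := hz x
    rw [eq_intCast, zsmul_eq_mul] at this
    rw [Int.cast_mul, this, ← mul_assoc, hdq]
  let E₀ : Matrix ι κ ℤ := Matrix.of fun i k => s * z (Sum.inl (i, k))
  let W₀ : Matrix τ ι ℤ := Matrix.of fun i k => s * z (Sum.inr (i, k))
  have hE' : E₀.map (Int.cast : ℤ → ℚ) = (d : ℚ) • E := by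
    ext i k
    exact hz' (Sum.inl (i, k))
  have hW' : W₀.map (Int.cast : ℤ → ℚ) = (d : ℚ) • W := by
    ext i k
    exact hz' (Sum.inr (i, k))
  have hd {α : Type} [DecidableEq α] : (d • (1 : Matrix α α ℤ)).map (Int.cast : ℤ → ℚ) =
      (d : ℚ) • 1 := by
    ext i j
    simp only [Matrix.map_apply, Matrix.smul_apply, Matrix.one_apply]
    split_ifs <;> simp
  refine ⟨d, E₀, W₀, hd0, hinj ?_, hinj ?_⟩
  · dsimp only
    rw [map_mul', hE', hd, Matrix.mul_smul, hE]
  · dsimp only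
    rw [Matrix.map_add _ (by simp), map_mul', map_mul', hE', hW', hd, Matrix.mul_smul,
      Matrix.smul_mul, ← smul_add, hW]

end LinearAlgebra


/-! ### Points of the torus over a `ℂ`-algebra -/

section TorusPow

variable {n : ℕ} {G H : Type} [CommGroup G] [CommGroup H]

/-- The character `x ^ b` of exponent `b` at the point `x` of a split torus. -/
def torusPow (x : Fin n → G) (b : Fin n → ℤ) : G :=
  ∏ l, x l ^ b l

theorem map_torusPow (φ : G →* H) (x : Fin n → G) (b : Fin n → ℤ) :
    φ (torusPow x b) = torusPow (fun l => φ (x l)) b := by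
  simp [torusPow]

theorem torusPow_single (x : Fin n → G) (l : Fin n) : torusPow x (Pi.single l 1) = x l := by
  rw [torusPow, Finset.prod_eq_single l] <;> simp +contextual

/-- The row of ones contributes a homogenizing coordinate `w`; the choice `w = x ^ (-a_0)` gives the
values `x ^ (a_i - a_0)` of a dual pair. -/
theorem matrixPow_cons_exponentMatrix {N : ℕ} (w : G) (x : Fin n → G) (a : Fin N → Fin n → ℤ)
    (i : Fin N) :
    matrixPow (Fin.cons w x : Fin (n + 1) → G) (exponentMatrix a) i = w * torusPow x (a i) := by
  simp [matrixPow, exponentMatrix, torusPow, Fin.prod_univ_succ]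

end TorusPow

section UnitEval

variable {n : ℕ} {S T : Type} [CommRing S] [Algebra ℂ S] [CommRing T] [Algebra ℂ T]

/-- Evaluation of Laurent polynomials at a point of the torus over a `ℂ`-algebra. -/
def unitEval (x : Fin n → Sˣ) : Laurent n →ₐ[ℂ] S :=
  AddMonoidAlgebra.lift ℂ S (Fin n → ℤ)
    { toFun b := (torusPow x b.toAdd : Sˣ)
      map_one' := by simp [torusPow]
      map_mul' b c := by simp [torusPow, zpow_add, Finset.prod_mul_distrib] }

theorem unitEval_single (x : Fin n → Sˣ) (b : Fin n → ℤ) (c : ℂ) :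
    unitEval x (AddMonoidAlgebra.single b c) = c • ((torusPow x b : Sˣ) : S) := by
  simp [unitEval, AddMonoidAlgebra.lift_single]

theorem laurentEval_eq_unitEval (x : Fin n → ℂˣ) : laurentEval x = unitEval x :=
  rfl

theorem comp_unitEval (φ : S →ₐ[ℂ] T) (x : Fin n → Sˣ) :
    φ.comp (unitEval x) = unitEval fun l => Units.map (φ : S →* T) (x l) := by
  refine AddMonoidAlgebra.algHom_ext (fun b => ?_) (Subsingleton.elim _ _)
  rw [AlgHom.comp_apply, unitEval_single, unitEval_single, map_smul, ← map_torusPow]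
  rfl

/-- The monomial `x ^ b` as a unit of the ring of Laurent polynomials. -/
def monomialUnit (b : Fin n → ℤ) : (Laurent n)ˣ :=
  (AddMonoidAlgebra.of ℂ (Fin n → ℤ)).toHomUnits (Multiplicative.ofAdd b)

theorem coe_monomialUnit (b : Fin n → ℤ) :
    (monomialUnit b : Laurent n) = AddMonoidAlgebra.single b 1 :=
  rfl

theorem torusPow_monomialUnit (b : Fin n → ℤ) :
    torusPow (fun l => monomialUnit (Pi.single l 1)) b = monomialUnit b := by
  have : b = ∑ l, b l • Pi.single l (1 : ℤ) := by
    funext j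
    simp [Finset.sum_apply, Pi.single_apply]
  conv_rhs => rw [this]
  simp only [monomialUnit, torusPow]
  rw [ofAdd_sum, map_prod]
  refine Finset.prod_congr rfl fun l _ => ?_
  rw [ofAdd_zsmul, map_zpow]

theorem eq_unitEval (φ : Laurent n →ₐ[ℂ] S) :
    φ = unitEval fun l => Units.map (φ : Laurent n →* S) (monomialUnit (Pi.single l 1)) := by
  refine AddMonoidAlgebra.algHom_ext (fun b => ?_) (Subsingleton.elim _ _)
  rw [unitEval_single, ← map_torusPow, torusPow_monomialUnit, one_smul]
  rfl

theorem unitEval_sparseSystem {N : ℕ} (C : Matrix (Fin n) (Fin N) ℂ) (a : Fin N → Fin n → ℤ)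
    (x : Fin n → Sˣ) (k : Fin n) :
    unitEval x (sparseSystem C a k) =
      (C.map (algebraMap ℂ S)).mulVec (fun j => ((torusPow x (a j) : Sˣ) : S)) k := by
  simp [sparseSystem, unitEval_single, Matrix.mulVec, dotProduct, Algebra.smul_def]

end UnitEval

/-! ### The Gale correspondence on points -/

section DualPoints

variable {n m N : ℕ} {S T : Type} [CommRing S] [Algebra ℂ S] [CommRing T] [Algebra ℂ T]

theorem aeval_rowPolynomial {D : Matrix (Fin N) (Fin (m + 1)) ℂ} (y : Fin m → S) (i : Fin N) :
    MvPolynomial.aeval y (rowPolynomial D i) =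
      (D.map (algebraMap ℂ S)).mulVec (Fin.cons 1 y) i := by
  simp [rowPolynomial, Matrix.mulVec, dotProduct, Fin.sum_univ_succ]

/-- Where the `p_i` are units, the negative exponents can be moved back across the equation. -/
theorem aeval_galeSystem_eq_zero_iff {B : Matrix (Fin N) (Fin m) ℤ}
    {D : Matrix (Fin N) (Fin (m + 1)) ℂ} {y : Fin m → S} {p : Fin N → Sˣ}
    (hp : ∀ i, MvPolynomial.aeval y (rowPolynomial D i) = p i) (k : Fin m) :
    MvPolynomial.aeval y (galeSystem B D k) = 0 ↔ matrixPow p B k = 1 := by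
  have hsplit : matrixPow p B k = (∏ i with 0 < B i k, p i ^ (B i k).toNat) *
      (∏ i with B i k < 0, p i ^ (-B i k).toNat)⁻¹ := by
    rw [matrixPow, Finset.prod_filter, Finset.prod_filter, ← Finset.prod_inv_distrib,
      ← Finset.prod_mul_distrib]
    refine Finset.prod_congr rfl fun i _ => ?_
    rcases lt_trichotomy (B i k) 0 with h | h | h
    · rw [if_neg h.not_gt, if_pos h, one_mul, ← zpow_natCast, Int.toNat_of_nonneg (by omega),
        zpow_neg, inv_inv]
    · simp [h]
    · rw [if_pos h, if_neg h.not_gt, inv_one, mul_one, ← zpow_natCast,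
        Int.toNat_of_nonneg h.le]
  rw [hsplit, mul_inv_eq_one, ← Units.val_inj, galeSystem, map_sub, sub_eq_zero]
  simp [map_prod, hp]

/-- A point `x` of the torus and a point `y` of affine space correspond to each other under Gale
duality if the polynomials `p_i` take the values `x ^ (a_i - a_0)` at `y`. -/
def IsDualPair (a : Fin (N + 1) → Fin n → ℤ) (D : Matrix (Fin (N + 1)) (Fin (m + 1)) ℂ)
    (x : Fin n → Sˣ) (y : Fin m → S) : Prop :=
  ∀ i, MvPolynomial.aeval y (rowPolynomial D i) =
    (((torusPow x (a 0))⁻¹ * torusPow x (a i) : Sˣ) : S)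

theorem IsDualPair.map {a : Fin (N + 1) → Fin n → ℤ} {D : Matrix (Fin (N + 1)) (Fin (m + 1)) ℂ}
    {x : Fin n → Sˣ} {y : Fin m → S} (h : IsDualPair a D x y) (φ : S →ₐ[ℂ] T) :
    IsDualPair a D (fun l => Units.map (φ : S →* T) (x l)) (fun j => φ (y j)) := by
  intro i
  have := congrArg φ (h i)
  rw [← map_torusPow, ← map_torusPow, ← map_inv, ← map_mul]
  have e : MvPolynomial.aeval (fun j => φ (y j)) (rowPolynomial D i) =
      φ (MvPolynomial.aeval y (rowPolynomial D i)) := by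
    rw [← AlgHom.comp_apply, MvPolynomial.comp_aeval]
  rw [e, this]
  rfl

/-- The values `p_i(y)` form the vector `D (1, y)`, and `L` inverts `D` on the left. -/
theorem IsDualPair.eq_right {a : Fin (N + 1) → Fin n → ℤ}
    {D : Matrix (Fin (N + 1)) (Fin (m + 1)) ℂ} {L : Matrix (Fin (m + 1)) (Fin (N + 1)) ℂ}
    (hL : L * D = 1) {x : Fin n → Sˣ} {y y' : Fin m → S} (h : IsDualPair a D x y)
    (h' : IsDualPair a D x y') : y = y' := by
  have e : (D.map (algebraMap ℂ S)).mulVec (Fin.cons 1 y) =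
      (D.map (algebraMap ℂ S)).mulVec (Fin.cons 1 y') := by
    funext i
    rw [← aeval_rowPolynomial, ← aeval_rowPolynomial, h i, h' i]
  have e2 := congrArg (L.map (algebraMap ℂ S)).mulVec e
  rw [Matrix.mulVec_mulVec, Matrix.mulVec_mulVec, ← Matrix.map_mul, hL,
    Matrix.map_one _ (map_zero _) (map_one _), Matrix.one_mulVec, Matrix.one_mulVec] at e2
  exact (Fin.cons_inj.1 e2).2

/-- Raising the values to the exponents `E` recovers only `x ^ d`; unipotence then pins down the
root. -/
theorem IsDualPair.eq_left {a : Fin (N + 1) → Fin n → ℤ}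
    {D : Matrix (Fin (N + 1)) (Fin (m + 1)) ℂ} {d : ℕ} (hd : d ≠ 0)
    {E : Matrix (Fin (N + 1)) (Fin (n + 1)) ℤ} (hE : exponentMatrix a * E = d • 1)
    {x x' : Fin n → Sˣ} (hx : ∀ l, x l ∈ unipotentUnits S) (hx' : ∀ l, x' l ∈ unipotentUnits S)
    {y : Fin m → S} (h : IsDualPair a D x y) (h' : IsDualPair a D x' y) : x = x' := by
  have e : matrixPow (Fin.cons (torusPow x (a 0))⁻¹ x : Fin (n + 1) → Sˣ) (exponentMatrix a) =
      matrixPow (Fin.cons (torusPow x' (a 0))⁻¹ x' : Fin (n + 1) → Sˣ) (exponentMatrix a) := by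
    funext i
    rw [matrixPow_cons_exponentMatrix, matrixPow_cons_exponentMatrix]
    exact Units.ext ((h i).symm.trans (h' i))
  funext l
  have e2 := congrFun (congrArg (fun p => matrixPow p E) e) l.succ
  rw [← matrixPow_mul, ← matrixPow_mul, hE, matrixPow_smul_one, matrixPow_smul_one, Fin.cons_succ,
    Fin.cons_succ] at e2
  exact eq_of_pow_eq_of_mem_unipotentUnits hd (hx l) (hx' l) e2

theorem IsDualPair.aeval_galeSystem {a : Fin (N + 1) → Fin n → ℤ}
    {B : Matrix (Fin (N + 1)) (Fin m) ℤ} (hB : exponentMatrix a * B = 0)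
    {D : Matrix (Fin (N + 1)) (Fin (m + 1)) ℂ} {x : Fin n → Sˣ} {y : Fin m → S}
    (h : IsDualPair a D x y) (k : Fin m) : MvPolynomial.aeval y (galeSystem B D k) = 0 := by
  rw [aeval_galeSystem_eq_zero_iff h]
  have : (fun i => (torusPow x (a 0))⁻¹ * torusPow x (a i)) =
      matrixPow (Fin.cons (torusPow x (a 0))⁻¹ x : Fin (n + 1) → Sˣ) (exponentMatrix a) := by
    funext i
    rw [matrixPow_cons_exponentMatrix]
  rw [this, ← matrixPow_mul, hB, matrixPow_zero]
  rfl

theorem IsDualPair.unitEval_sparseSystem {a : Fin (N + 1) → Fin n → ℤ}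
    {C : Matrix (Fin n) (Fin (N + 1)) ℂ} {D : Matrix (Fin (N + 1)) (Fin (m + 1)) ℂ}
    (hCD : C * D = 0) {x : Fin n → Sˣ} {y : Fin m → S}
    (h : IsDualPair a D x y) (k : Fin n) : unitEval x (sparseSystem C a k) = 0 := by
  rw [LocalGale.unitEval_sparseSystem]
  have : (fun j => ((torusPow x (a j) : Sˣ) : S)) =
      ((torusPow x (a 0) : Sˣ) : S) • (D.map (algebraMap ℂ S)).mulVec (Fin.cons 1 y) := by
    funext j
    rw [Pi.smul_apply, ← aeval_rowPolynomial, h j, smul_eq_mul, ← Units.val_mul,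
      mul_inv_cancel_left]
  rw [this, Matrix.mulVec_smul, Matrix.mulVec_mulVec, ← Matrix.map_mul, hCD,
    Matrix.map_zero _ (map_zero _), Matrix.zero_mulVec, smul_zero]
  rfl

/-- The Gale dual of a solution of the sparse system. -/
theorem exists_isDualPair_of_sparseSystem {a : Fin (N + 1) → Fin n → ℤ}
    {C : Matrix (Fin n) (Fin (N + 1)) ℂ} {D : Matrix (Fin (N + 1)) (Fin (m + 1)) ℂ}
    {X : Matrix (Fin (N + 1)) (Fin n) ℂ} {L : Matrix (Fin (m + 1)) (Fin (N + 1)) ℂ}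
    (hXL : X * C + D * L = 1) (hrow : ∀ j, D 0 j = if j = 0 then 1 else 0) {x : Fin n → Sˣ}
    (hx : ∀ k, unitEval x (sparseSystem C a k) = 0) : ∃ y : Fin m → S, IsDualPair a D x y := by
  let u : Fin (N + 1) → S := fun i => (((torusPow x (a 0))⁻¹ * torusPow x (a i) : Sˣ) : S)
  have hCu : (C.map (algebraMap ℂ S)).mulVec u = 0 := by
    have : u = (((torusPow x (a 0))⁻¹ : Sˣ) : S) • fun i => ((torusPow x (a i) : Sˣ) : S) := by
      funext i
      simp [u]
    rw [this, Matrix.mulVec_smul]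
    funext k
    rw [Pi.smul_apply, ← LocalGale.unitEval_sparseSystem, hx, smul_zero]
    rfl
  -- As `C u = 0`, the identity `X C + D L = 1` gives `u = D v`. Row `0` of `D` and `u 0 = 1` then
  -- give `v 0 = 1`, so `v = (1, y)`.
  set v := (L.map (algebraMap ℂ S)).mulVec u with hv
  have hDv : (D.map (algebraMap ℂ S)).mulVec v = u := by
    have h1 : ((X * C + D * L).map (algebraMap ℂ S)).mulVec u = u := by
      rw [hXL, Matrix.map_one _ (map_zero _) (map_one _), Matrix.one_mulVec]
    rwa [Matrix.map_add _ (map_add _), Matrix.map_mul, Matrix.map_mul, Matrix.add_mulVec,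
      ← Matrix.mulVec_mulVec, ← Matrix.mulVec_mulVec, hCu, Matrix.mulVec_zero, zero_add,
      ← hv] at h1
  have hv0 : v 0 = 1 := by
    have h0 := congrFun hDv 0
    simpa [u, Matrix.mulVec, dotProduct, hrow, apply_ite (algebraMap ℂ S)] using h0
  refine ⟨Fin.tail v, fun i => ?_⟩
  rw [aeval_rowPolynomial, ← hv0, Fin.cons_self_tail, hDv]

/-- The Gale dual of a solution of the Gale system that is infinitesimally near to the origin. -/
theorem exists_isDualPair_of_galeSystem {a : Fin (N + 1) → Fin n → ℤ}
    {B : Matrix (Fin (N + 1)) (Fin m) ℤ} {D : Matrix (Fin (N + 1)) (Fin (m + 1)) ℂ} {d : ℕ}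
    (hd : d ≠ 0) {E : Matrix (Fin (N + 1)) (Fin (n + 1)) ℤ} {W : Matrix (Fin m) (Fin (N + 1)) ℤ}
    (hEW : E * exponentMatrix a + B * W = d • 1) (hcol : ∀ i, D i 0 = 1)
    (hrow : ∀ j : Fin m, D 0 j.succ = 0) {y : Fin m → S} (hy : ∀ j, IsNilpotent (y j))
    (hg : ∀ k, MvPolynomial.aeval y (galeSystem B D k) = 0) :
    ∃ x : Fin n → Sˣ, (∀ l, x l ∈ unipotentUnits S) ∧ IsDualPair a D x y := by
  have hnil (i) : IsNilpotent (MvPolynomial.aeval y (rowPolynomial D i) - 1) := by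
    have : MvPolynomial.aeval y (rowPolynomial D i) - 1 =
        ∑ j : Fin m, algebraMap ℂ S (D i j.succ) * y j := by
      simp [rowPolynomial, hcol]
    rw [this]
    exact isNilpotent_sum fun j _ => (Commute.all _ _).isNilpotent_mul_left (hy j)
  have hunit (i) : IsUnit (MvPolynomial.aeval y (rowPolynomial D i)) := by
    simpa using (hnil i).isUnit_one_add
  let p : Fin (N + 1) → Sˣ := fun i => (hunit i).unit
  have hp (i) : p i ∈ unipotentUnits S := hnil i
  have hp0 : p 0 = 1 := by
    ext
    simp [p, rowPolynomial, hcol, hrow]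
  have hpB : matrixPow p B = 1 := by
    funext k
    exact (aeval_galeSystem_eq_zero_iff (p := p) (fun i => rfl) k).1 (hg k)
  -- The coordinates of `x` are unipotent `d`-th roots of `p ^ E`, including the homogenizing one `x
  -- 0`.
  choose x hx hxd using fun l => exists_pow_eq_of_mem_unipotentUnits hd
    (matrixPow_mem (unipotentUnits S) hp E l)
  -- With `A` the exponent matrix, both sides have the same `d`-th power: `p ^ (E A) = p ^ (E A + B
  -- W) = p ^ d`, because `p ^ B = 1`.
  have hxp : matrixPow x (exponentMatrix a) = p := by
    funext i
    refine eq_of_pow_eq_of_mem_unipotentUnits hd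
      (matrixPow_mem (unipotentUnits S) hx (exponentMatrix a) i) (hp i) ?_
    have hxE : (fun l => x l ^ d) = matrixPow p E := funext hxd
    have h1 : matrixPow x (exponentMatrix a) i ^ d =
        matrixPow (fun l => x l ^ d) (exponentMatrix a) i :=
      map_matrixPow (powMonoidHom d) x (exponentMatrix a) i
    rw [h1, hxE, ← matrixPow_mul, ← matrixPow_smul_one p d i, ← hEW, matrixPow_add,
      matrixPow_mul p B W, hpB, matrixPow_one, mul_one]
  have hxa (i) : p i = x 0 * torusPow (Fin.tail x) (a i) := by
    rw [← matrixPow_cons_exponentMatrix, Fin.cons_self_tail, hxp]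
  refine ⟨Fin.tail x, fun l => hx l.succ, fun i => ?_⟩
  have hx0 : x 0 = (torusPow (Fin.tail x) (a 0))⁻¹ := by
    rw [eq_inv_iff_mul_eq_one, ← hxa, hp0]
  rw [← hx0, ← hxa]
  rfl

end DualPoints


/-! ### Algebras of jets -/

section Jets

variable {R R' ι ι' : Type} [CommRing R] [Algebra ℂ R] [CommRing R'] [Algebra ℂ R']

/-- The algebra of jets of order less than `k` of the scheme `f = 0` at the point `q`. -/
abbrev Jets (f : ι → R) (q : R →ₐ[ℂ] ℂ) (k : ℕ) : Type :=
  R ⧸ (Ideal.span (Set.range f) ⊔ RingHom.ker q ^ k)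

/-- The quotient map onto the algebra of jets. -/
def toJets (f : ι → R) (q : R →ₐ[ℂ] ℂ) (k : ℕ) : R →ₐ[ℂ] Jets f q k :=
  Ideal.Quotient.mkₐ ℂ _

theorem toJets_eq_zero (f : ι → R) (q : R →ₐ[ℂ] ℂ) (k : ℕ) (i : ι) : toJets f q k (f i) = 0 :=
  Ideal.Quotient.eq_zero_iff_mem.2
    (Ideal.mem_sup_left (Ideal.subset_span (Set.mem_range_self i)))

theorem toJets_surjective (f : ι → R) (q : R →ₐ[ℂ] ℂ) (k : ℕ) :
    Function.Surjective (toJets f q k) :=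
  Ideal.Quotient.mk_surjective

theorem isNilpotent_toJets (f : ι → R) {q : R →ₐ[ℂ] ℂ} (k : ℕ) {r : R} (hr : q r = 0) :
    IsNilpotent (toJets f q k r) := by
  refine ⟨k, ?_⟩
  rw [← map_pow]
  exact Ideal.Quotient.eq_zero_iff_mem.2 (Ideal.mem_sup_right (Ideal.pow_mem_pow hr k))

/-- A homomorphism to jets that is compatible with the points and the equations factors through
jets. -/
theorem exists_jetMap {f : ι → R} {q : R →ₐ[ℂ] ℂ} {f' : ι' → R'} {q' : R' →ₐ[ℂ] ℂ} {k : ℕ}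
    (hk : k ≠ 0) (hf' : ∀ i, q' (f' i) = 0) (φ : R →ₐ[ℂ] Jets f' q' k) (hφ : ∀ i, φ (f i) = 0)
    (hq : ∀ ε : Jets f' q' k →ₐ[ℂ] ℂ, ε.comp φ = q) :
    ∃ ψ : Jets f q k →ₐ[ℂ] Jets f' q' k, ψ.comp (toJets f q k) = φ := by
  have hle : Ideal.span (Set.range f') ⊔ RingHom.ker q' ^ k ≤ RingHom.ker q' := by
    refine sup_le (Ideal.span_le.2 ?_) (Ideal.pow_le_self hk)
    rintro _ ⟨i, rfl⟩
    exact hf' i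
  -- Evaluation at `q'` descends to jets because `k ≠ 0`. Composed with `φ` it is `q`, so `φ`
  -- carries `ker q` into the image of `ker q'`, whose `k`-th power vanishes.
  let ε : Jets f' q' k →ₐ[ℂ] ℂ := Ideal.Quotient.liftₐ _ q' fun r hr => hle hr
  have hm {r : R} (hr : r ∈ RingHom.ker q) :
      φ r ∈ (RingHom.ker q').map (toJets f' q' k) := by
    obtain ⟨r', hr'⟩ := toJets_surjective f' q' k (φ r)
    have h1 : q' r' = 0 := by
      have h2 : ε (φ r) = q r := congrArg (fun φ => φ r) (hq ε)
      rw [← hr'] at h2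
      exact h2.trans hr
    rw [← hr']
    exact Ideal.mem_map_of_mem _ h1
  have hpow : RingHom.ker q ^ k ≤ RingHom.ker φ := by
    have h1 : (RingHom.ker q ^ k).map φ ≤ ((RingHom.ker q') ^ k).map (toJets f' q' k) := by
      rw [Ideal.map_pow, Ideal.map_pow]
      exact Ideal.pow_right_mono (Ideal.map_le_of_le_comap fun r hr => Ideal.mem_comap.2 (hm hr)) k
    have h2 : ((RingHom.ker q') ^ k).map (toJets f' q' k) = ⊥ := by
      rw [eq_bot_iff, Ideal.map_le_iff_le_comap]
      intro r hr
      exact Ideal.Quotient.eq_zero_iff_mem.2 (Ideal.mem_sup_right hr)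
    rw [h2] at h1
    intro r hr
    exact h1 (Ideal.mem_map_of_mem _ hr)
  have hker : Ideal.span (Set.range f) ⊔ RingHom.ker q ^ k ≤ RingHom.ker φ := by
    refine sup_le (Ideal.span_le.2 ?_) hpow
    rintro _ ⟨i, rfl⟩
    exact hφ i
  exact ⟨Ideal.Quotient.liftₐ _ φ fun r hr => hker hr, Ideal.Quotient.liftₐ_comp _ _ _⟩

end Jets

/-! ### The isomorphism of jets -/

section GaleDuality

variable {n m N : ℕ}

theorem eq_one_of_mem_unipotentUnits {x : Fin n → ℂˣ} (hx : ∀ l, x l ∈ unipotentUnits ℂ) :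
    x = 1 := by
  funext l
  have := IsNilpotent.eq_zero (mem_unipotentUnits.1 (hx l))
  exact Units.ext (sub_eq_zero.1 this)

/-- Gale duality for jets: the two systems have isomorphic jets of every order. -/
theorem rank_jets_eq {a : Fin (N + 1) → Fin n → ℤ} {B : Matrix (Fin (N + 1)) (Fin m) ℤ}
    {C : Matrix (Fin n) (Fin (N + 1)) ℂ} {D : Matrix (Fin (N + 1)) (Fin (m + 1)) ℂ}
    (hB : exponentMatrix a * B = 0) {d : ℕ} (hd : d ≠ 0)
    {E : Matrix (Fin (N + 1)) (Fin (n + 1)) ℤ} (hE : exponentMatrix a * E = d • 1)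
    {W : Matrix (Fin m) (Fin (N + 1)) ℤ} (hEW : E * exponentMatrix a + B * W = d • 1)
    (hCD : C * D = 0) {X : Matrix (Fin (N + 1)) (Fin n) ℂ}
    {L : Matrix (Fin (m + 1)) (Fin (N + 1)) ℂ} (hL : L * D = 1) (hXL : X * C + D * L = 1)
    (hcol : ∀ i, D i 0 = 1) (hrow : ∀ j : Fin m, D 0 j.succ = 0)
    (hf : ∀ k, laurentEval 1 (sparseSystem C a k) = 0)
    (hg : ∀ k, MvPolynomial.aeval (0 : Fin m → ℂ) (galeSystem B D k) = 0) {k : ℕ} (hk : k ≠ 0) :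
    Module.rank ℂ (Jets (sparseSystem C a) (laurentEval 1) k) =
      Module.rank ℂ (Jets (galeSystem B D) (MvPolynomial.aeval (0 : Fin m → ℂ)) k) := by
  let S₁ := Jets (sparseSystem C a) (laurentEval 1) k
  let S₂ := Jets (galeSystem B D) (MvPolynomial.aeval (0 : Fin m → ℂ)) k
  let π₁ : Laurent n →ₐ[ℂ] S₁ := toJets (sparseSystem C a) (laurentEval 1) k
  let π₂ : MvPolynomial (Fin m) ℂ →ₐ[ℂ] S₂ := toJets (galeSystem B D) (MvPolynomial.aeval 0) k
  -- `x₁` and `y₂` are the universal points: evaluation at them is the quotient map onto jets.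
  let x₁ : Fin n → S₁ˣ := fun l => Units.map (π₁ : Laurent n →* S₁) (monomialUnit (Pi.single l 1))
  let y₂ : Fin m → S₂ := fun j => π₂ (MvPolynomial.X j)
  have hπ₁ : π₁ = unitEval x₁ := eq_unitEval π₁
  have hπ₂ : π₂ = MvPolynomial.aeval y₂ := MvPolynomial.aeval_unique π₂
  have hx₁ (l) : x₁ l ∈ unipotentUnits S₁ := by
    have h0 : laurentEval (1 : Fin n → ℂˣ) ((monomialUnit (Pi.single l 1) : Laurent n) - 1) = 0 := by
      rw [map_sub, map_one, laurentEval_eq_unitEval, coe_monomialUnit, unitEval_single,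
        torusPow_single]
      simp
    have := isNilpotent_toJets (sparseSystem C a) k h0
    rwa [map_sub, map_one] at this
  have hy₂ (j) : IsNilpotent (y₂ j) :=
    isNilpotent_toJets (galeSystem B D) k (MvPolynomial.aeval_X _ _)
  have hrow' (j) : D 0 j = if j = 0 then 1 else 0 := by
    refine Fin.cases ?_ (fun j => ?_) j
    · simp [hcol]
    · simp [hrow]
  obtain ⟨y₁, hxy₁⟩ := exists_isDualPair_of_sparseSystem (a := a) hXL hrow' (x := x₁)
    fun i => hπ₁ ▸ toJets_eq_zero (sparseSystem C a) (laurentEval 1) k i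
  obtain ⟨x₂, hx₂, hxy₂⟩ := exists_isDualPair_of_galeSystem (a := a) hd hEW hcol hrow hy₂
    fun i => hπ₂ ▸ toJets_eq_zero (galeSystem B D) (MvPolynomial.aeval 0) k i
  have hdual : IsDualPair a D (1 : Fin n → ℂˣ) (0 : Fin m → ℂ) := by
    intro i
    simp [torusPow, rowPolynomial, hcol]
  obtain ⟨ψ, hψ⟩ := exists_jetMap (f := sparseSystem C a) (q := laurentEval 1) hk hg
    (unitEval x₂) (fun i => hxy₂.unitEval_sparseSystem hCD i) fun ε => by
      rw [comp_unitEval, laurentEval_eq_unitEval]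
      exact congrArg unitEval (eq_one_of_mem_unipotentUnits fun l =>
        map_mem_unipotentUnits (ε : S₂ →+* ℂ) (hx₂ l))
  obtain ⟨φ, hφ⟩ := exists_jetMap (f := galeSystem B D) (q := MvPolynomial.aeval 0) hk hf
    (MvPolynomial.aeval y₁) (fun i => hxy₁.aeval_galeSystem hB i) fun ε => by
      rw [MvPolynomial.comp_aeval]
      have h1 := hxy₁.map ε
      have h2 : (fun l => Units.map (ε : S₁ →* ℂ) (x₁ l)) = 1 :=
        eq_one_of_mem_unipotentUnits fun l => map_mem_unipotentUnits (ε : S₁ →+* ℂ) (hx₁ l)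
      rw [h2] at h1
      exact congrArg MvPolynomial.aeval (h1.eq_right hL hdual)
  have hφy : (fun j => φ (y₂ j)) = y₁ := by
    funext j
    exact (congrArg (fun φ => φ (MvPolynomial.X j)) hφ).trans (MvPolynomial.aeval_X _ _)
  have hψx : (fun l => Units.map (ψ : S₁ →* S₂) (x₁ l)) = x₂ := by
    funext l
    refine Units.ext ((congrArg (fun ψ => ψ (monomialUnit (Pi.single l 1) : Laurent n)) hψ).trans ?_)
    rw [coe_monomialUnit, unitEval_single, torusPow_single, one_smul]
  -- Both sides are unipotent and dual to `y₁`. Uniqueness of dual points, here and for `y₂` below,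
  -- makes `φ` and `ψ` mutually inverse.
  have hφx : (fun l => Units.map (φ : S₂ →* S₁) (x₂ l)) = x₁ :=
    IsDualPair.eq_left hd hE (fun l => map_mem_unipotentUnits (φ : S₂ →+* S₁) (hx₂ l)) hx₁
      (hφy ▸ hxy₂.map φ) hxy₁
  have hψy : (fun j => ψ (y₁ j)) = y₂ :=
    IsDualPair.eq_right hL (hψx ▸ hxy₁.map ψ) hxy₂
  have hφψ : φ.comp ψ = AlgHom.id ℂ S₁ := by
    refine Ideal.Quotient.algHom_ext _ ?_
    change (φ.comp ψ).comp π₁ = π₁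
    rw [AlgHom.comp_assoc, hψ, comp_unitEval, hφx, hπ₁]
  have hψφ : ψ.comp φ = AlgHom.id ℂ S₂ := by
    refine Ideal.Quotient.algHom_ext _ ?_
    change (ψ.comp φ).comp π₂ = π₂
    rw [AlgHom.comp_assoc, hφ, MvPolynomial.comp_aeval, hψy, hπ₂]
  exact (AlgEquiv.ofAlgHom ψ φ hψφ hφψ).toLinearEquiv.rank_eq

end GaleDuality

/-! ### Finite multiplicity implies isolation; conclusion -/

section Isolated

variable {n m : ℕ} {ι : Type}

instance : IsNoetherianRing (Laurent n) :=
  Algebra.FiniteType.isNoetherianRing ℂ (Laurent n)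

theorem continuous_laurentEval (r : Laurent n) : Continuous fun x : Fin n → ℂˣ => laurentEval x r := by
  induction r using AddMonoidAlgebra.induction_linear with
  | zero => simpa using continuous_const
  | add f g hf hg =>
    simp only [map_add]
    exact hf.add hg
  | single b c =>
    simp only [laurentEval_eq_unitEval, unitEval_single, torusPow]
    have h : Continuous fun x : Fin n → ℂˣ => ∏ l, x l ^ b l :=
      continuous_finsetProd _ fun l _ => (continuous_apply l).zpow _
    exact (Units.continuous_val.comp h).const_smul c

/-- Isolation is automatic for a finite multiplicity; the functions `x_l - 1` separate `1` from all
other points. -/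
theorem isIsolatedTorusRoot_one_iff {f : ι → Laurent n} (hf : ∀ i, laurentEval 1 (f i) = 0) (μ : ℕ) :
    IsIsolatedTorusRoot f 1 μ ↔ localMultiplicity f (laurentEval 1) = μ := by
  refine ⟨fun h => h.2, fun h => ⟨?_, h⟩⟩
  refine isIsolatedIn_of_localMultiplicity_eq (z := laurentEval) continuous_laurentEval
    (fun l : Fin n => (monomialUnit (Pi.single l 1) : Laurent n) - 1) ?_ ?_ hf h
  · intro l
    simp [laurentEval_eq_unitEval, coe_monomialUnit, unitEval_single, torusPow_single]
  · intro x hx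
    funext l
    have := hx l
    rw [map_sub, map_one, laurentEval_eq_unitEval, coe_monomialUnit, unitEval_single,
      torusPow_single, one_smul, sub_eq_zero] at this
    exact Units.ext this

theorem isIsolatedAffineRoot_zero_iff {g : ι → MvPolynomial (Fin m) ℂ}
    (hg : ∀ i, MvPolynomial.aeval (0 : Fin m → ℂ) (g i) = 0) (μ : ℕ) :
    IsIsolatedAffineRoot g 0 μ ↔ localMultiplicity g (MvPolynomial.aeval 0) = μ := by
  refine ⟨fun h => h.2, fun h => ⟨?_, h⟩⟩
  refine isIsolatedIn_of_localMultiplicity_eq (z := fun y => MvPolynomial.aeval y) ?_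
    (MvPolynomial.X : Fin m → MvPolynomial (Fin m) ℂ) ?_ ?_ hg h
  · intro r
    exact MvPolynomial.continuous_eval r
  · intro j
    simp
  · intro y hy
    funext j
    simpa using hy j

end Isolated

theorem isIsolatedTorusRoot_iff_isIsolatedAffineRoot {n m : ℕ} {a : Fin (n + m + 1) → Fin n → ℤ}
    {C : Matrix (Fin n) (Fin (n + m + 1)) ℂ}
    (hA : ((exponentMatrix a).map (Int.cast : ℤ → ℚ)).rank = n + 1) (hC : C.rank = n)
    {B : Matrix (Fin (n + m + 1)) (Fin m) ℤ} {D : Matrix (Fin (n + m + 1)) (Fin (m + 1)) ℂ}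
    (hB : IsGaleDualExponents a B) (hD : IsReducedGaleDual C D) (μ : ℕ) :
    IsIsolatedTorusRoot (sparseSystem C a) 1 μ ↔ IsIsolatedAffineRoot (galeSystem B D) 0 μ := by
  obtain ⟨d, E, W, hd, hE, hEW⟩ := exists_int_splitting hB.mul_eq_zero (by simpa using hA)
    (by simpa using hB.rank_eq) (by simp; omega)
  have hCD : C * D = 0 := by
    ext i j
    have : D.col j ∈ LinearMap.ker C.mulVecLin := by
      rw [← hD.span_eq]
      exact Submodule.subset_span (Set.mem_range_self j)
    exact congrFun (LinearMap.mem_ker.1 this) i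
  have hDrank : D.rank = Fintype.card (Fin (m + 1)) := by
    rw [Matrix.rank_eq_finrank_span_cols]
    exact finrank_span_eq_card hD.linearIndependent
  obtain ⟨X, L, -, hL, hXL⟩ := exists_splitting hCD (by simpa using hC) hDrank (by simp; omega)
  have hdual : IsDualPair a D (1 : Fin n → ℂˣ) (0 : Fin m → ℂ) := by
    intro i
    simp [torusPow, rowPolynomial, hD.col_zero]
  have hf (k) : laurentEval 1 (sparseSystem C a k) = 0 := hdual.unitEval_sparseSystem hCD k
  have hg (k) : MvPolynomial.aeval (0 : Fin m → ℂ) (galeSystem B D k) = 0 :=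
    hdual.aeval_galeSystem hB.mul_eq_zero k
  have hrank {k : ℕ} (hk : k ≠ 0) := rank_jets_eq hB.mul_eq_zero hd hE hEW hCD hL hXL hD.col_zero
    hD.row_zero hf hg hk
  rw [isIsolatedTorusRoot_one_iff hf, isIsolatedAffineRoot_zero_iff hg,
    localMultiplicity_eq_iff hf, localMultiplicity_eq_iff hg]
  constructor
  · rintro ⟨K, hK⟩
    -- The bound `K + 1` ensures `k ≠ 0`, as the comparison of jets requires.
    exact ⟨K + 1, fun k hk => (hrank (by omega)).symm.trans (hK k (by omega))⟩
  · rintro ⟨K, hK⟩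
    exact ⟨K + 1, fun k hk => (hrank (by omega)).trans (hK k (by omega))⟩

end LocalGale

end

theorem mainTheorem6 (n m : ℕ) (a : Fin (n + m + 1) → Fin n → ℤ)
    (C : Matrix (Fin n) (Fin (n + m + 1)) ℂ)
    (ha : Function.Injective a)
    (hA : ((LocalGale.exponentMatrix a).map (Int.cast : ℤ → ℚ)).rank = n + 1)
    (hC : C.rank = n) :
    (∀ (B : Matrix (Fin (n + m + 1)) (Fin m) ℤ) (D : Matrix (Fin (n + m + 1)) (Fin (m + 1)) ℂ),
      LocalGale.IsGaleDualExponents a B → LocalGale.IsReducedGaleDual C D →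
      ∀ μ : ℕ,
        LocalGale.IsIsolatedTorusRoot (LocalGale.sparseSystem C a) 1 μ ↔
          LocalGale.IsIsolatedAffineRoot (LocalGale.galeSystem B D) 0 μ) ∧
    (∀ (B B' : Matrix (Fin (n + m + 1)) (Fin m) ℤ)
      (D D' : Matrix (Fin (n + m + 1)) (Fin (m + 1)) ℂ),
      LocalGale.IsGaleDualExponents a B → LocalGale.IsGaleDualExponents a B' →
      LocalGale.IsReducedGaleDual C D → LocalGale.IsReducedGaleDual C D' →
      ∀ μ : ℕ,
        LocalGale.IsIsolatedAffineRoot (LocalGale.galeSystem B D) 0 μ ↔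
          LocalGale.IsIsolatedAffineRoot (LocalGale.galeSystem B' D') 0 μ) := by
  have key (B : Matrix (Fin (n + m + 1)) (Fin m) ℤ) (D : Matrix (Fin (n + m + 1)) (Fin (m + 1)) ℂ)
      (hB : LocalGale.IsGaleDualExponents a B) (hD : LocalGale.IsReducedGaleDual C D) (μ : ℕ) :=
    LocalGale.isIsolatedTorusRoot_iff_isIsolatedAffineRoot hA hC hB hD μ
  exact ⟨key, fun B B' D D' hB hB' hD hD' μ => (key B D hB hD μ).symm.trans (key B' D' hB' hD' μ)⟩
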